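/- Let $\Delta=\{z\in\mathbb C:|z|<1\}$, let $\beta\ge 1$ be real, and let $v(z)=\exp\left(\frac{-1}{1-|z|^\beta}\right)$ for $z\in\Delta$. Let $\mathcal H_{v_o}(\Delta)$ be the complex normed space of all holomorphic functions $f\colon\Delta\to\mathbb C$ with $\|f\|_v:=\sup_{z\in\Delta}v(z)|f(z)|<\infty$ such that for every $\varepsilon>0$ there is a compact set $K\subset\Delta$ with $v(z)|f(z)|<\varepsilon$ for all $z\in\Delta\setminus K$, with the norm $\|\cdot\|_v$. Then for every $\mathbb C$-linear (not necessarily surjective) isometry $T\colon\mathcal H_{v_o}(\Delta)\to\mathcal H_{v_o}(\Delta)$ there are a complex number $\alpha$ with $|\alpha|=1$ and a real number $\theta$ such that $T(f)(z)=\alpha f(e^{i\theta}z)$ for all $f\in\mathcal H_{v_o}(\Delta)$ and all $z\in\Delta$. In particular, every such $T$ is surjective. -/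

import Mathlib

open Set Filter Topology TopologicalSpace

noncomputable section

/-- A weight on an open set `U` of the complex plane: a continuous, bounded, strictly positive
real valued function on `U`. -/
structure HolWeight (U : Opens ℂ) where
  toFun : U → ℝ
  continuous_toFun : Continuous toFun
  bounded : ∃ C : ℝ, ∀ z, toFun z ≤ C
  pos : ∀ z, 0 < toFun z

instance {U : Opens ℂ} : CoeFun (HolWeight U) (fun _ => U → ℝ) := ⟨HolWeight.toFun⟩

/-- A function `f : U → ℂ` is holomorphic on the open set `U` if its extension by zero
to the plane is complex differentiable on `U`. -/
def IsHolomorphicFun {U : Opens ℂ} (f : U → ℂ) : Prop :=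
  DifferentiableOn ℂ (Function.extend (Subtype.val : U → ℂ) f 0) (U : Set ℂ)

theorem extend_val_apply {U : Opens ℂ} (f : U → ℂ) {z : ℂ} (hz : z ∈ U) :
    Function.extend (Subtype.val : U → ℂ) f 0 z = f ⟨z, hz⟩ :=
  Subtype.val_injective.extend_apply f 0 (⟨z, hz⟩ : U)

/-- The vector space of holomorphic functions `f` on `U` for which `v * |f|` is bounded. -/
def weightedHolSubmodule {U : Opens ℂ} (v : HolWeight U) : Submodule ℂ (U → ℂ) where
  carrier := {f | IsHolomorphicFun f ∧ BddAbove (range fun z => v z * ‖f z‖)}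
  zero_mem' := by
    refine ⟨(differentiableOn_const (0 : ℂ)).congr fun z hz => ?_, 0, ?_⟩
    · rw [extend_val_apply _ hz]; rfl
    · rintro _ ⟨z, rfl⟩; simp
  add_mem' := by
    rintro f g ⟨hf, a, ha⟩ ⟨hg, b, hb⟩
    refine ⟨(DifferentiableOn.add hf hg).congr fun z hz => ?_, a + b, ?_⟩
    · simp only [Pi.add_apply, extend_val_apply _ hz]
    · rintro _ ⟨z, rfl⟩
      have h1 := ha ⟨z, rfl⟩
      have h2 := hb ⟨z, rfl⟩
      have h3 := mul_le_mul_of_nonneg_left (norm_add_le (f z) (g z)) (v.pos z).le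
      simp only [Pi.add_apply] at *
      linarith
  smul_mem' := by
    rintro c f ⟨hf, a, ha⟩
    refine ⟨(DifferentiableOn.const_smul hf c).congr fun z hz => ?_, ‖c‖ * a, ?_⟩
    · simp only [Pi.smul_apply, extend_val_apply _ hz]
    · rintro _ ⟨z, rfl⟩
      have h1 := mul_le_mul_of_nonneg_left (ha ⟨z, rfl⟩) (norm_nonneg c)
      simp only [Pi.smul_apply, norm_smul] at *
      linarith

/-- The space `H_v(U)` of holomorphic functions on `U` with `sup v |f| < ∞`. (A separate type, so
that it carries only the topology of the weighted norm below.) -/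
def Hv {U : Opens ℂ} (v : HolWeight U) : Type := weightedHolSubmodule v

namespace Hv

variable {U : Opens ℂ} {v : HolWeight U}

instance : AddCommGroup (Hv v) := inferInstanceAs (AddCommGroup (weightedHolSubmodule v))

instance : Module ℂ (Hv v) := inferInstanceAs (Module ℂ (weightedHolSubmodule v))

instance : FunLike (Hv v) U ℂ where
  coe f := f.1
  coe_injective := Subtype.val_injective

/-- The weighted supremum norm. -/
instance : Norm (Hv v) := ⟨fun f => ⨆ z : U, v z * ‖f z‖⟩

theorem norm_def (f : Hv v) : ‖f‖ = ⨆ z : U, v z * ‖f z‖ := rfl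

@[simp] theorem zero_apply (z : U) : (0 : Hv v) z = 0 := rfl

@[simp] theorem add_apply (f g : Hv v) (z : U) : (f + g) z = f z + g z := rfl

@[simp] theorem smul_apply (c : ℂ) (f : Hv v) (z : U) : (c • f) z = c * f z := rfl

theorem le_norm (f : Hv v) (z : U) : v z * ‖f z‖ ≤ ‖f‖ := le_ciSup f.2.2 z

theorem normCore : NormedSpace.Core ℂ (Hv v) where
  norm_nonneg f := Real.iSup_nonneg fun z => mul_nonneg (v.pos z).le (norm_nonneg _)
  norm_smul c f := by
    rw [norm_def, norm_def, Real.mul_iSup_of_nonneg (norm_nonneg c)]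
    congr 1; ext z
    rw [smul_apply, norm_mul]; ring
  norm_triangle f g := by
    refine Real.iSup_le (fun z => ?_) (add_nonneg
      (Real.iSup_nonneg fun z => mul_nonneg (v.pos z).le (norm_nonneg _))
      (Real.iSup_nonneg fun z => mul_nonneg (v.pos z).le (norm_nonneg _)))
    have h1 := le_norm f z
    have h2 := le_norm g z
    have h3 := mul_le_mul_of_nonneg_left (norm_add_le (f z) (g z)) (v.pos z).le
    rw [add_apply]
    linarith
  norm_eq_zero_iff f := by
    constructor
    · intro h
      refine DFunLike.ext _ _ fun z => ?_
      have h1 := le_norm f z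
      rw [h] at h1
      rw [zero_apply, ← norm_le_zero_iff]
      exact nonpos_of_mul_nonpos_right h1 (v.pos z)
    · rintro rfl
      simp [norm_def]

instance : NormedAddCommGroup (Hv v) := NormedAddCommGroup.ofCore normCore

instance : NormedSpace ℂ (Hv v) := NormedSpace.ofCore normCore

end Hv

/-- The subspace `H_{v_o}(U)` of `H_v(U)`, with the same norm: all `f` such that for each `ε > 0`
there is a compact `K ⊆ U` with `v |f| < ε` on `U \ K`. -/
def Hvo {U : Opens ℂ} (v : HolWeight U) : Submodule ℂ (Hv v) where
  carrier := {f | ∀ ε : ℝ, 0 < ε → ∃ K : Set U, IsCompact K ∧ ∀ z ∉ K, v z * ‖f z‖ < ε}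
  zero_mem' := fun ε hε => ⟨∅, isCompact_empty, fun z _ => by simpa using hε⟩
  add_mem' := by
    intro f g hf hg ε hε
    obtain ⟨K, hK, h1⟩ := hf (ε / 2) (half_pos hε)
    obtain ⟨L, hL, h2⟩ := hg (ε / 2) (half_pos hε)
    refine ⟨K ∪ L, hK.union hL, fun z hz => ?_⟩
    have h1 := h1 z fun h => hz (Or.inl h)
    have h2 := h2 z fun h => hz (Or.inr h)
    have h3 := mul_le_mul_of_nonneg_left (norm_add_le (f z) (g z)) (v.pos z).le
    rw [Hv.add_apply]
    linarith
  smul_mem' := by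
    intro c f hf ε hε
    have hc : 0 < ‖c‖ + 1 := by positivity
    obtain ⟨K, hK, h1⟩ := hf (ε / (‖c‖ + 1)) (div_pos hε hc)
    refine ⟨K, hK, fun z hz => ?_⟩
    have h1 := (lt_div_iff₀ hc).1 (h1 z hz)
    have h2 : 0 ≤ v z * ‖f z‖ := mul_nonneg (v.pos z).le (norm_nonneg _)
    rw [Hv.smul_apply, norm_mul]
    nlinarith

/-- The open unit disc `Δ`. -/
def openDisc : Opens ℂ := ⟨Metric.ball 0 1, Metric.isOpen_ball⟩

theorem mem_openDisc {z : ℂ} : z ∈ openDisc ↔ ‖z‖ < 1 := mem_ball_zero_iff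

/-- The rotation `z ↦ e^{iθ} z` of the disc. -/
def discRotation (θ : ℝ) (z : openDisc) : openDisc :=
  ⟨Complex.exp (θ * Complex.I) * z, by
    rw [mem_openDisc, norm_mul, Complex.norm_exp_ofReal_mul_I, one_mul]
    exact mem_openDisc.1 z.2⟩

/-- The weight `v(z) = exp (-1 / (1 - |z|^β))` on the disc, for `β ≥ 1`. -/
def expWeight (β : ℝ) (hβ : 1 ≤ β) : HolWeight openDisc where
  toFun z := Real.exp (-1 / (1 - ‖(z : ℂ)‖ ^ β))
  continuous_toFun := by
    have h0 : 0 < β := by linarith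
    refine Real.continuous_exp.comp (continuous_const.div (continuous_const.sub
      ((continuous_norm.comp continuous_subtype_val).rpow_const fun _ => Or.inr h0.le))
      fun z => ?_)
    have := Real.rpow_lt_one (norm_nonneg (z : ℂ)) (mem_openDisc.1 z.2) h0
    exact (sub_pos.2 this).ne'
  bounded := by
    refine ⟨1, fun z => Real.exp_le_one_iff.2 ?_⟩
    have := Real.rpow_lt_one (norm_nonneg (z : ℂ)) (mem_openDisc.1 z.2) (by linarith : 0 < β)
    exact div_nonpos_of_nonpos_of_nonneg (by norm_num) (by linarith)
  pos _ := Real.exp_pos _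

end

/-!
Write `v = e^{-u}` with `u(z) = 1 / (1 - |z|^β)`.

For `β ≥ 1` the function `u` is strictly convex in `|z|`, so for `z = |z| e` and a suitable `k ≥ 0`
the entire function `p(ζ) = exp (k ē ζ)` makes `v |p|` maximal at `z` and nowhere else
(`Hvo.exists_peak`). If `v |T p|` attains its maximum at `w`, then `f ↦ v(w) (T f)(w)` is a
functional of norm at most `1` that attains its norm at `p`; perturbing `p` shows that it kills every
`f` with `f z = 0` (`Hvo.apply_eq_zero_of_peak`). Hence `(T f)(w) = g(w) f(z)` for all `f`, where
`g = T 1`, and `v(w) |g(w)| = v(z)`. Each `z` in the disc has such a `w`, so there are uncountably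
many `w`, and the identity theorem gives `(T ζ^n) g^(n-1) = (T ζ)^n` on the disc. Boundedness of
these powers makes `σ = T ζ / g` a holomorphic map of the disc to itself, and `T f = g · (f ∘ σ)`
(`exists_weighted_composition`).

The equality `v |g| = v ∘ σ` so far holds on a relatively closed set that `σ` maps onto the disc. As
`σ` is a local homeomorphism off a countable set, Baire's theorem gives that set an interior point,
and off a countable set the logarithms of both sides are real analytic, so the equality holds
everywhere (`weight_eq_on_ball`). In particular `log |g| = u - u ∘ σ` is harmonic.

Let `σ p = 0` and let `φ` be the disc automorphism with `φ 0 = p`. By the Schwarz lemma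
`|σ (φ ζ)| ≤ |ζ|`, hence `log |g (φ ζ)| ≥ u (φ ζ) - u ζ`. Near the boundary `u` is asymptotic to
`(2 / β) / (1 - |ζ|^2)`, and the mean of `1 / (1 - |φ ζ|^2)` over a circle `|ζ| = r` close to the
boundary is about `(1 + |p|^2) / (1 - |p|^2)` times `1 / (1 - r^2)`. The mean of `log |g ∘ φ|` is
constant, so `p = 0` (`eq_zero_of_apply_eq_zero`). Now `|σ w| ≤ |w|` gives `|g| ≥ 1 = |g 0|`, hence
`g` is a unimodular constant, `|σ w| = |w|`, and `σ` is a rotation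
(`exists_eq_rotation_of_weight_eq`). Rotating back shows that `T` is surjective.
-/

/-! ### Zeros, quotients and images of holomorphic functions -/

theorem AnalyticOnNhd.countable_zeros {f : ℂ → ℂ} {U : Set ℂ} (hf : AnalyticOnNhd ℂ f U)
    (hU : IsPreconnected U) (hne : ∃ w ∈ U, f w ≠ 0) : {w ∈ U | f w = 0}.Countable := by
  obtain ⟨w, hw, hfw⟩ := hne
  have h := (hf.eqOn_zero_or_eventually_ne_zero_of_preconnected hU).resolve_left
    fun h => hfw (h hw)
  have h2 : {w ∈ U | f w = 0}ᶜ ∈ codiscreteWithin U := by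
    filter_upwards [h] with x hx hx2 using hx hx2.2
  have h3 : IsDiscrete ({w ∈ U | f w = 0} ∩ U) := isDiscrete_of_codiscreteWithin h2
  exact ((HereditarilyLindelofSpace.isLindelof _).countable_of_isDiscrete h3).mono
    (subset_inter subset_rfl fun x hx => hx.1)

theorem AnalyticOnNhd.eqOn_of_not_countable {f g : ℂ → ℂ} {U S : Set ℂ}
    (hf : AnalyticOnNhd ℂ f U) (hg : AnalyticOnNhd ℂ g U) (hU : IsPreconnected U)
    (hSU : S ⊆ U) (hS : ¬ S.Countable) (hfg : EqOn f g S) : EqOn f g U := by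
  by_contra hne
  simp only [EqOn, not_forall] at hne
  obtain ⟨w, hw, hfw⟩ := hne
  refine hS (((hf.sub hg).countable_zeros hU ⟨w, hw, sub_ne_zero.2 hfw⟩).mono fun x hx => ?_)
  exact ⟨hSU hx, sub_eq_zero.2 (hfg hx)⟩

/-- The disc is homeomorphic to the plane, where this is known. -/
theorem isPreconnected_unitBall_diff_of_countable {s : Set ℂ} (hs : s.Countable) :
    IsPreconnected (Metric.ball (0 : ℂ) 1 \ s) := by
  let e : ℂ → ℂ := fun z => (Homeomorph.unitBall z : ℂ)
  have he : Continuous e := continuous_subtype_val.comp Homeomorph.unitBall.continuous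
  have hinj : Function.Injective e :=
    Subtype.val_injective.comp Homeomorph.unitBall.injective
  have hc : (e ⁻¹' s).Countable := hs.preimage hinj
  have h := (hc.isConnected_compl_of_one_lt_rank
    (by simp)).isPreconnected.image e he.continuousOn
  convert h using 1
  ext z
  constructor
  · rintro ⟨hz, hzs⟩
    have : e (Homeomorph.unitBall.symm ⟨z, hz⟩) = z := by simp [e]
    exact ⟨Homeomorph.unitBall.symm ⟨z, hz⟩, by simpa [this] using hzs, this⟩
  · rintro ⟨x, hx, rfl⟩
    exact ⟨(Homeomorph.unitBall x).2, hx⟩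

/-- Where `G` vanishes, `σ` is the continuous extension of `H / G`; the bound makes the poles
removable. -/
theorem exists_analytic_quotient {G H : ℂ → ℂ} {U : Set ℂ} (hU : IsOpen U)
    (hUc : IsPreconnected U) (hG : AnalyticOnNhd ℂ G U) (hH : AnalyticOnNhd ℂ H U)
    (hne : ∃ w ∈ U, G w ≠ 0) (hle : ∀ w ∈ U, G w ≠ 0 → ‖H w‖ ≤ ‖G w‖) :
    ∃ σ : ℂ → ℂ, AnalyticOnNhd ℂ σ U ∧ ∀ w ∈ U, H w = G w * σ w ∧ ‖σ w‖ ≤ 1 := by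
  have hq : MeromorphicOn (fun z => H z / G z) U := fun z hz =>
    (hH z hz).meromorphicAt.div (hG z hz).meromorphicAt
  have hG0 : ∀ z ∈ U, ∀ᶠ w in 𝓝[≠] z, G w ≠ 0 := by
    intro z hz
    by_contra hcon
    obtain ⟨w, hw, hw0⟩ := hne
    refine hw0 (hG.eqOn_zero_of_preconnected_of_frequently_eq_zero hUc hz ?_ hw)
    rw [Filter.not_eventually] at hcon
    exact hcon.mono fun x hx => not_not.1 hx
  have hb : ∀ z ∈ U, ∀ᶠ w in 𝓝[≠] z, ‖H w / G w‖ ≤ 1 := by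
    intro z hz
    filter_upwards [hG0 z hz, nhdsWithin_le_nhds (hU.mem_nhds hz)] with w hw hwU
    rw [norm_div]
    exact div_le_one_of_le₀ (hle w hwU hw) (norm_nonneg _)
  have hσ : AnalyticOnNhd ℂ (toMeromorphicNFOn (fun z => H z / G z) U) U := by
    intro z hz
    rw [← (meromorphicNFOn_toMeromorphicNFOn _ U hz).meromorphicOrderAt_nonneg_iff_analyticAt,
      meromorphicOrderAt_toMeromorphicNFOn hq hz]
    by_contra! hneg
    have h1 := tendsto_norm_cobounded_atTop.comp
      ((tendsto_cobounded_iff_meromorphicOrderAt_neg (hq z hz)).2 hneg)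
    have h2 := h1.eventually_gt_atTop 1
    obtain ⟨w, hw1, hw2⟩ := (h2.and (hb z hz)).exists
    exact absurd hw2 (not_le.2 hw1)
  have heq : ∀ z ∈ U, ∀ᶠ w in 𝓝[≠] z,
      toMeromorphicNFOn (fun z => H z / G z) U w = H w / G w :=
    fun z hz => hq.toMeromorphicNFOn_eq_self_on_nhdsNE hz
  refine ⟨_, hσ, fun w hw => ⟨?_, ?_⟩⟩
  · refine tendsto_nhds_unique ((hH w hw).continuousAt.tendsto.mono_left nhdsWithin_le_nhds)
      ((((hG w hw).continuousAt.mul (hσ w hw).continuousAt).tendsto.mono_left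
        (nhdsWithin_le_nhds (s := {w}ᶜ))).congr' ?_)
    filter_upwards [heq w hw, hG0 w hw] with x hx hx0
    rw [Pi.mul_apply, hx, mul_div_cancel₀ _ hx0]
  · refine le_of_tendsto ((hσ w hw).continuousAt.norm.tendsto.mono_left
      (nhdsWithin_le_nhds (s := {w}ᶜ))) ?_
    filter_upwards [heq w hw, hb w hw] with x hx hx0
    rwa [hx]

/-- If a holomorphic `σ` maps a relatively closed subset of `U` onto a set with nonempty interior,
then that subset has nonempty interior: off the countably many critical points it is covered by
countably many compact sets on which `σ` is injective, and Baire's theorem applies to their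
images. -/
theorem interior_nonempty_of_ball_subset_image {σ : ℂ → ℂ} {φ : ℂ → ℝ} {U V : Set ℂ} (hU : IsOpen U)
    (hUc : IsPreconnected U) (hσ : AnalyticOnNhd ℂ σ U) (hφ : ContinuousOn φ U)
    (hV : IsOpen V) (hVne : V.Nonempty) (hsurj : V ⊆ σ '' {w ∈ U | φ w = 0}) :
    (interior {w ∈ U | φ w = 0}).Nonempty := by
  by_contra hint
  rw [not_nonempty_iff_eq_empty] at hint
  have hder : ∃ w ∈ U, deriv σ w ≠ 0 := by
    by_contra! hz
    obtain ⟨a, ha⟩ := hU.exists_is_const_of_deriv_eq_zero hUc hσ.differentiableOn hz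
    have hVa : V ⊆ {a} := fun z hz => by
      obtain ⟨w, hw, rfl⟩ := hsurj hz
      exact ha w hw.1
    have := hV.interior_eq ▸ interior_mono hVa
    rw [interior_singleton] at this
    exact hVne.ne_empty (subset_empty_iff.1 this)
  have hC := hσ.deriv.countable_zeros hUc hder
  set C := {w ∈ U | deriv σ w = 0}
  have hloc : ∀ w ∈ U \ C, ∃ K ∈ 𝓝 w, IsNowhereDense (σ '' (K ∩ {w ∈ U | φ w = 0})) := by
    rintro w ⟨hw, hwC⟩
    have hd : deriv σ w ≠ 0 := fun h => hwC ⟨hw, h⟩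
    have hs := (hσ w hw).hasStrictDerivAt.hasStrictFDerivAt_equiv hd
    set e := hs.toOpenPartialHomeomorph σ
    have hes : w ∈ e.source := hs.mem_toOpenPartialHomeomorph_source
    have hecoe : (e : ℂ → ℂ) = σ := hs.toOpenPartialHomeomorph_coe
    obtain ⟨r, hr, hrs⟩ := Metric.nhds_basis_closedBall.mem_iff.1
      (Filter.inter_mem (e.open_source.mem_nhds hes) (hU.mem_nhds hw))
    refine ⟨_, Metric.closedBall_mem_nhds w hr, ?_⟩
    have hcl : IsCompact (Metric.closedBall w r ∩ {w ∈ U | φ w = 0}) := by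
      have h1 : IsClosed (Metric.closedBall w r ∩ φ ⁻¹' {0}) :=
        (hφ.mono fun x hx => (hrs hx).2).preimage_isClosed_of_isClosed
          Metric.isClosed_closedBall isClosed_singleton
      refine (isCompact_closedBall w r).of_isClosed_subset ?_ inter_subset_left
      convert h1 using 1
      ext x
      exact ⟨fun hx => ⟨hx.1, hx.2.2⟩, fun hx => ⟨hx.1, (hrs hx.1).2, hx.2⟩⟩
    have hcont : ContinuousOn σ (Metric.closedBall w r ∩ {w ∈ U | φ w = 0}) :=
      hσ.continuousOn.mono fun x hx => hx.2.1
    rw [(hcl.image_of_continuousOn hcont).isClosed.isNowhereDense_iff]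
    by_contra hne
    obtain ⟨b, hb⟩ := nonempty_iff_ne_empty.2 hne
    have hopen : IsOpen (e.source ∩ e ⁻¹' interior
        (σ '' (Metric.closedBall w r ∩ {w ∈ U | φ w = 0}))) :=
      e.isOpen_inter_preimage isOpen_interior
    have hsub : e.source ∩ e ⁻¹' interior (σ '' (Metric.closedBall w r ∩ {w ∈ U | φ w = 0}))
        ⊆ {w ∈ U | φ w = 0} := by
      rintro x ⟨hx, hxb⟩
      obtain ⟨y, hy, hyx⟩ := interior_subset hxb
      have : y = x := e.injOn (hrs hy.1).1 hx (by rw [← hyx, hecoe])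
      exact this ▸ hy.2
    obtain ⟨y, hy, rfl⟩ := interior_subset hb
    have : y ∈ interior {w ∈ U | φ w = 0} :=
      interior_maximal hsub hopen ⟨(hrs hy.1).1, by rw [hecoe]; exact hb⟩
    rw [hint] at this
    exact this
  choose! K hKn hKd using hloc
  obtain ⟨t, hts, htc, hcov⟩ := countable_cover_nhdsWithin
    (fun x hx => mem_nhdsWithin_of_mem_nhds (hKn x hx))
  refine not_isMeagre_of_isOpen hV hVne ?_
  have h1 : IsMeagre (⋃ x ∈ t, σ '' (K x ∩ {w ∈ U | φ w = 0})) :=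
    isMeagre_biUnion htc fun x hx => (hKd x (hts hx)).isMeagre
  have h2 : IsMeagre (⋃ x ∈ C, ({σ x} : Set ℂ)) :=
    isMeagre_biUnion hC fun x _ => IsNowhereDense.isMeagre (by
      rw [isClosed_singleton.isNowhereDense_iff, interior_singleton])
  refine (h1.union h2).mono fun z hz => ?_
  obtain ⟨w, hw, rfl⟩ := hsurj hz
  by_cases hwC : w ∈ C
  · exact Or.inr (mem_biUnion hwC rfl)
  · obtain ⟨x, hx, hwx⟩ := mem_iUnion₂.1 (hcov ⟨hw.1, hwC⟩)
    exact Or.inl (mem_biUnion hx ⟨w, ⟨hwx, hw⟩, rfl⟩)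

/-! ### Propagation of the weight equality -/

/-- The formula for the weight `expWeight β`, as a function on the whole plane. -/
noncomputable def discWeight (β : ℝ) (z : ℂ) : ℝ := Real.exp (-1 / (1 - ‖z‖ ^ β))

theorem expWeight_apply (β : ℝ) (hβ : 1 ≤ β) (z : openDisc) :
    expWeight β hβ z = discWeight β z := rfl

theorem discWeight_pos (β : ℝ) (z : ℂ) : 0 < discWeight β z := Real.exp_pos _

theorem one_sub_norm_rpow_pos {β : ℝ} (hβ : 0 < β) {z : ℂ} (hz : ‖z‖ < 1) : 0 < 1 - ‖z‖ ^ β :=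
  sub_pos.2 (Real.rpow_lt_one (norm_nonneg z) hz hβ)

theorem continuousOn_discWeight {β : ℝ} (hβ : 0 < β) :
    ContinuousOn (discWeight β) (Metric.ball 0 1) := by
  refine Real.continuous_exp.comp_continuousOn (continuousOn_const.div
    (continuousOn_const.sub (continuous_norm.continuousOn.rpow_const fun _ _ => Or.inr hβ.le)) ?_)
  intro z hz
  exact (one_sub_norm_rpow_pos hβ (mem_ball_zero_iff.1 hz)).ne'

theorem AnalyticAt.log_norm_real {f : ℂ → ℂ} {w : ℂ} (hf : AnalyticAt ℂ f w) (h0 : f w ≠ 0) :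
    AnalyticAt ℝ (fun z => Real.log ‖f z‖) w := by
  have hr : AnalyticAt ℝ f w := hf.restrictScalars
  have hre : AnalyticAt ℝ (fun z => (f z).re) w := (Complex.reCLM.analyticAt _).comp hr
  have him : AnalyticAt ℝ (fun z => (f z).im) w := (Complex.imCLM.analyticAt _).comp hr
  have h1 : AnalyticAt ℝ (fun z => (f z).re * (f z).re + (f z).im * (f z).im) w :=
    (hre.mul hre).add (him.mul him)
  have h2 : 0 < (f w).re * (f w).re + (f w).im * (f w).im := by
    have := Complex.normSq_pos.2 h0
    rwa [Complex.normSq_apply] at this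
  have h3 : AnalyticAt ℝ
      (fun z => Real.log ((f z).re * (f z).re + (f z).im * (f z).im)) w :=
    AnalyticAt.comp (g := Real.log) (x := w)
      (f := fun z => (f z).re * (f z).re + (f z).im * (f z).im) (analyticAt_log h2) h1
  refine ((analyticAt_const (v := (1 / 2 : ℝ))).mul h3).congr ?_
  refine Eventually.of_forall fun z => ?_
  have : (f z).re * (f z).re + (f z).im * (f z).im = ‖f z‖ ^ 2 := by
    rw [← Complex.normSq_eq_norm_sq, Complex.normSq_apply]
  simp only [Pi.mul_apply, this, Real.log_pow]
  push_cast
  ring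

/-- The function `-log v ∘ f` is real analytic where the holomorphic map `f` into the disc does not
vanish. At zeros of `f` it can fail, `|z|^β` being singular at `0` unless `β` is even. -/
theorem AnalyticAt.one_div_one_sub_norm_rpow {f : ℂ → ℂ} {w : ℂ} {β : ℝ} (hβ : 0 < β)
    (hf : AnalyticAt ℂ f w) (h0 : f w ≠ 0) (h1 : ‖f w‖ < 1) :
    AnalyticAt ℝ (fun z => 1 / (1 - ‖f z‖ ^ β)) w := by
  have hp : AnalyticAt ℝ (fun z => Real.exp (Real.log ‖f z‖ * β)) w :=
    ((hf.log_norm_real h0).mul analyticAt_const).rexp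
  have hne : 1 - Real.exp (Real.log ‖f w‖ * β) ≠ 0 := by
    rw [← Real.rpow_def_of_pos (norm_pos_iff.2 h0)]
    exact (one_sub_norm_rpow_pos hβ h1).ne'
  refine ((analyticAt_const (v := (1 : ℝ))).div (analyticAt_const.sub hp) hne).congr ?_
  filter_upwards [hf.continuousAt.eventually_ne h0] with z hz
  simp only [Pi.div_apply, Pi.sub_apply, Real.rpow_def_of_pos (norm_pos_iff.2 hz)]

/-- The equality `v |g| = v ∘ σ` holds on the whole disc as soon as `σ` maps its solution set
onto the disc. -/
theorem weight_eq_on_ball {β : ℝ} (hβ : 0 < β) {σ g : ℂ → ℂ}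
    (hσ : AnalyticOnNhd ℂ σ (Metric.ball 0 1)) (hg : AnalyticOnNhd ℂ g (Metric.ball 0 1))
    (hmaps : MapsTo σ (Metric.ball 0 1) (Metric.ball 0 1))
    (hsurj : ∀ z ∈ Metric.ball (0 : ℂ) 1, ∃ w ∈ Metric.ball (0 : ℂ) 1, σ w = z ∧
      discWeight β w * ‖g w‖ = discWeight β z) :
    ∀ w ∈ Metric.ball (0 : ℂ) 1, discWeight β w * ‖g w‖ = discWeight β (σ w) := by
  set U := Metric.ball (0 : ℂ) 1
  have hUo : IsOpen U := Metric.isOpen_ball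
  have hUc : IsPreconnected U := (convex_ball _ _).isPreconnected
  have hv := continuousOn_discWeight hβ
  have hφ : ContinuousOn (fun w => discWeight β w * ‖g w‖ - discWeight β (σ w)) U :=
    (hv.mul hg.continuousOn.norm).sub (hv.comp hσ.continuousOn hmaps)
  obtain ⟨w₀, hw₀⟩ := interior_nonempty_of_ball_subset_image hUo hUc hσ hφ hUo
    ⟨0, by simp [U]⟩ fun z hz => by
      obtain ⟨w, hw, rfl, h⟩ := hsurj z hz
      exact ⟨w, ⟨hw, sub_eq_zero.2 h⟩, rfl⟩
  set Y := {w ∈ U | discWeight β w * ‖g w‖ - discWeight β (σ w) = 0} with hY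
  have hYg : ∀ w ∈ Y, g w ≠ 0 := by
    rintro w ⟨_, hw⟩ h0
    rw [h0, norm_zero, mul_zero, zero_sub, neg_eq_zero] at hw
    exact (discWeight_pos β _).ne' hw
  -- the exceptional set, where the logarithms below are not real analytic
  have hZ1 := hg.countable_zeros hUc ⟨w₀, (interior_subset hw₀).1, hYg _ (interior_subset hw₀)⟩
  have hZ2 : {w ∈ U | σ w = 0}.Countable := by
    obtain ⟨w, hw, hw2, -⟩ := hsurj (1 / 2) (by simp [U]; norm_num)
    exact hσ.countable_zeros hUc ⟨w, hw, by rw [hw2]; norm_num⟩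
  have hZ := (hZ1.union hZ2).union (countable_singleton (0 : ℂ))
  set Z := ({w ∈ U | g w = 0} ∪ {w ∈ U | σ w = 0}) ∪ {0}
  have hDc := isPreconnected_unitBall_diff_of_countable hZ
  have hdense : Dense Zᶜ := hZ.dense_compl ℝ
  have hF : AnalyticOnNhd ℝ (fun w => Real.log ‖g w‖ - 1 / (1 - ‖w‖ ^ β) +
      1 / (1 - ‖σ w‖ ^ β)) (U \ Z) := by
    rintro w ⟨hw, hwZ⟩
    simp only [Z, mem_union, not_or] at hwZ
    refine (((hg w hw).log_norm_real fun h => hwZ.1.1 ⟨hw, h⟩).sub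
      (analyticAt_id.one_div_one_sub_norm_rpow hβ hwZ.2 ?_)).add
      ((hσ w hw).one_div_one_sub_norm_rpow hβ (fun h => hwZ.1.2 ⟨hw, h⟩) ?_)
    · simpa [U] using hw
    · simpa [U] using hmaps hw
  have hiff : ∀ w ∈ U, g w ≠ 0 → ((Real.log ‖g w‖ - 1 / (1 - ‖w‖ ^ β) +
      1 / (1 - ‖σ w‖ ^ β) = 0) ↔ w ∈ Y) := by
    intro w hw hgw
    simp only [hY, mem_ofPred_eq, hw, true_and, discWeight]
    conv_rhs => rw [← Real.exp_log (norm_pos_iff.2 hgw), ← Real.exp_add, sub_eq_zero,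
      Real.exp_eq_exp]
    rw [neg_div, neg_div]
    constructor <;> intro h <;> linarith
  obtain ⟨w₁, hw₁, hw₁Z⟩ := hdense.inter_open_nonempty _ isOpen_interior ⟨w₀, hw₀⟩
  have hzero := hF.eqOn_zero_of_preconnected_of_eventuallyEq_zero hDc
    ⟨(interior_subset hw₁).1, hw₁Z⟩ (by
      filter_upwards [mem_interior_iff_mem_nhds.1 hw₁] with w hw
      exact (hiff w hw.1 (hYg w hw)).2 hw)
  have hYall : U \ Z ⊆ Y := fun w hw => (hiff w hw.1 fun h => hw.2 (Or.inl (Or.inl ⟨hw.1, h⟩))).1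
    (hzero hw)
  intro w hw
  have hcl : w ∈ closure (U \ Z) := by
    have := hdense.open_subset_closure_inter hUo hw
    rwa [← sdiff_eq] at this
  have hc : ContinuousWithinAt (fun w => discWeight β w * ‖g w‖ - discWeight β (σ w)) (U \ Z) w :=
    (hφ w hw).mono sdiff_subset
  have hmem := hc.mem_closure (t := {0}) hcl
    (fun x hx => (hYall hx).2)
  rw [closure_singleton] at hmem
  exact sub_eq_zero.1 hmem

/-! ### Symbols satisfying the weight equality are rotations -/

open ComplexConjugate in
/-- The disc automorphism `ζ ↦ (ζ + p) / (1 + p̄ ζ)`, which sends `0` to `p`. -/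
noncomputable def discShift (p ζ : ℂ) : ℂ := (ζ + p) / (1 + conj p * ζ)

open ComplexConjugate in
theorem one_add_conj_mul_ne_zero {p ζ : ℂ} (hp : ‖p‖ < 1) (hζ : ‖ζ‖ < 1) :
    1 + conj p * ζ ≠ 0 := by
  intro h
  have h1 : ‖conj p * ζ‖ < 1 := by
    rw [norm_mul, RCLike.norm_conj]
    exact mul_lt_one_of_nonneg_of_lt_one_left (norm_nonneg _) hp hζ.le
  rw [← neg_eq_of_add_eq_zero_right h, norm_neg, norm_one] at h1
  exact lt_irrefl _ h1

open ComplexConjugate in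
theorem norm_sq_one_add_conj_mul (p ζ : ℂ) :
    ‖1 + conj p * ζ‖ ^ 2 = 1 + 2 * (conj p * ζ).re + ‖p‖ ^ 2 * ‖ζ‖ ^ 2 := by
  simp only [← Complex.normSq_eq_norm_sq, Complex.normSq_apply, Complex.add_re, Complex.add_im,
    Complex.mul_re, Complex.mul_im, Complex.conj_re, Complex.conj_im, Complex.one_re,
    Complex.one_im]
  ring

open ComplexConjugate in
theorem one_sub_norm_sq_discShift {p ζ : ℂ} (hp : ‖p‖ < 1) (hζ : ‖ζ‖ < 1) :
    1 - ‖discShift p ζ‖ ^ 2 = (1 - ‖p‖ ^ 2) * (1 - ‖ζ‖ ^ 2) / ‖1 + conj p * ζ‖ ^ 2 := by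
  have h0 : ‖1 + conj p * ζ‖ ^ 2 ≠ 0 :=
    pow_ne_zero 2 (norm_ne_zero_iff.2 (one_add_conj_mul_ne_zero hp hζ))
  rw [discShift, norm_div, div_pow, eq_div_iff h0, sub_mul, div_mul_cancel₀ _ h0]
  simp only [← Complex.normSq_eq_norm_sq, Complex.normSq_apply, Complex.add_re, Complex.add_im,
    Complex.mul_re, Complex.mul_im, Complex.conj_re, Complex.conj_im, Complex.one_re,
    Complex.one_im]
  ring

theorem norm_discShift_lt_one {p ζ : ℂ} (hp : ‖p‖ < 1) (hζ : ‖ζ‖ < 1) :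
    ‖discShift p ζ‖ < 1 := by
  have h := one_sub_norm_sq_discShift hp hζ
  have h1 : 0 < 1 - ‖discShift p ζ‖ ^ 2 := by
    rw [h]
    refine div_pos (mul_pos ?_ ?_)
      (pow_pos (norm_pos_iff.2 (one_add_conj_mul_ne_zero hp hζ)) 2)
    · nlinarith [norm_nonneg p]
    · nlinarith [norm_nonneg ζ]
  nlinarith [norm_nonneg (discShift p ζ)]

theorem discShift_zero (p : ℂ) : discShift p 0 = p := by simp [discShift]

open ComplexConjugate in
theorem differentiableOn_discShift {p : ℂ} (hp : ‖p‖ < 1) :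
    DifferentiableOn ℂ (discShift p) (Metric.ball 0 1) := by
  intro ζ hζ
  have := one_add_conj_mul_ne_zero hp (mem_ball_zero_iff.1 hζ)
  have h1 : DifferentiableAt ℂ (fun ζ : ℂ => ζ + p) ζ := by fun_prop
  have h2 : DifferentiableAt ℂ (fun ζ : ℂ => 1 + conj p * ζ) ζ := by fun_prop
  exact (h1.div h2 this).differentiableWithinAt

/-- As `s → 1`, `1 / (1 - s ^ β)` is asymptotic to `(2 / β) / (1 - s ^ 2)`. -/
theorem exists_abs_one_div_one_sub_rpow_le {β ε : ℝ} (hβ : 0 < β) (hε : 0 < ε) :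
    ∃ C : ℝ, ∀ s : ℝ, 0 ≤ s → s < 1 →
      |1 / (1 - s ^ β) - 2 / β / (1 - s ^ 2)| ≤ ε / (1 - s ^ 2) + C := by
  have hlim : Tendsto (fun s : ℝ => (1 - s ^ 2) / (1 - s ^ β)) (𝓝[<] 1) (𝓝 (2 / β)) := by
    have h1 : Tendsto (slope (fun s : ℝ => s ^ β) 1) (𝓝[<] 1) (𝓝 β) := by
      have := (Real.hasDerivAt_rpow_const (x := 1) (p := β) (Or.inl one_ne_zero))
      rw [Real.one_rpow, mul_one] at this
      exact (hasDerivAt_iff_tendsto_slope.1 this).mono_left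
        (nhdsWithin_mono _ fun x hx => ne_of_lt hx)
    have h2 : Tendsto (slope (fun s : ℝ => s ^ 2) 1) (𝓝[<] 1) (𝓝 2) := by
      have := hasDerivAt_pow 2 (1 : ℝ)
      norm_num at this
      exact (hasDerivAt_iff_tendsto_slope.1 this).mono_left
        (nhdsWithin_mono _ fun x hx => ne_of_lt hx)
    refine (h2.div h1 hβ.ne').congr' ?_
    filter_upwards [self_mem_nhdsWithin] with s hs
    have hs' : s - 1 ≠ 0 := sub_ne_zero.2 (ne_of_lt hs)
    simp only [slope_def_field, Real.one_rpow, one_pow, Pi.div_apply]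
    rw [div_div_div_cancel_right₀ hs', ← neg_sub, ← neg_sub (1 : ℝ) (s ^ β), neg_div_neg_eq]
  have hev := hlim (Metric.ball_mem_nhds _ hε)
  obtain ⟨δ, hδ1, hδ⟩ := (mem_nhdsLT_iff_exists_mem_Ico_Ioo_subset zero_lt_one).1 hev
  have hδβ : 0 < 1 - δ ^ β := sub_pos.2 (Real.rpow_lt_one hδ1.1 hδ1.2 hβ)
  have hδ2 : 0 < 1 - δ ^ 2 := by nlinarith [hδ1.1, hδ1.2]
  refine ⟨1 / (1 - δ ^ β) + 2 / β / (1 - δ ^ 2), fun s hs0 hs1 => ?_⟩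
  have hsβ : 0 < 1 - s ^ β := sub_pos.2 (Real.rpow_lt_one hs0 hs1 hβ)
  have hs2 : 0 < 1 - s ^ 2 := by nlinarith
  rcases lt_or_ge δ s with h | h
  · have h3 : |(1 - s ^ 2) / (1 - s ^ β) - 2 / β| < ε := by
      simpa [Real.dist_eq] using hδ ⟨h, hs1⟩
    have h4 : 1 / (1 - s ^ β) - 2 / β / (1 - s ^ 2) =
        ((1 - s ^ 2) / (1 - s ^ β) - 2 / β) / (1 - s ^ 2) := by
      field_simp
    rw [h4, abs_div, abs_of_pos hs2]
    have : |(1 - s ^ 2) / (1 - s ^ β) - 2 / β| / (1 - s ^ 2) ≤ ε / (1 - s ^ 2) := by gcongr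
    have : 0 ≤ 1 / (1 - δ ^ β) + 2 / β / (1 - δ ^ 2) := by positivity
    linarith
  · have h5 : 1 / (1 - s ^ β) ≤ 1 / (1 - δ ^ β) := by gcongr
    have h6 : 2 / β / (1 - s ^ 2) ≤ 2 / β / (1 - δ ^ 2) := by gcongr
    have h7 : 0 ≤ 1 / (1 - s ^ β) := by positivity
    have h8 : 0 ≤ 2 / β / (1 - s ^ 2) := by positivity
    have h9 : 0 ≤ ε / (1 - s ^ 2) := by positivity
    rw [abs_le]
    constructor <;> linarith

theorem log_norm_eq_of_weight_eq {β : ℝ} {σ g : ℂ → ℂ} {w : ℂ}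
    (h : discWeight β w * ‖g w‖ = discWeight β (σ w)) :
    g w ≠ 0 ∧ Real.log ‖g w‖ = 1 / (1 - ‖w‖ ^ β) - 1 / (1 - ‖σ w‖ ^ β) := by
  have hg : g w ≠ 0 := by
    intro h0
    rw [h0, norm_zero, mul_zero] at h
    exact (discWeight_pos β _).ne h
  refine ⟨hg, ?_⟩
  have := congrArg Real.log h
  rw [Real.log_mul (discWeight_pos β w).ne' (norm_ne_zero_iff.2 hg), discWeight, discWeight,
    Real.log_exp, Real.log_exp, neg_div, neg_div] at this
  linarith

theorem one_div_one_sub_rpow_le {β s t : ℝ} (hβ : 0 < β) (hs : 0 ≤ s) (hst : s ≤ t) (ht : t < 1) :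
    1 / (1 - s ^ β) ≤ 1 / (1 - t ^ β) :=
  one_div_le_one_div_of_le (sub_pos.2 (Real.rpow_lt_one (hs.trans hst) ht hβ))
    (sub_le_sub_left (Real.rpow_le_rpow hs hst hβ.le) 1)

open ComplexConjugate in
/-- A self-map `σ` of the disc satisfying `v |g| = v ∘ σ` can vanish only at the origin. Instead of
averaging `log |g ∘ φ|` over circles, the proof applies the maximum principle to
`exp (κ p̄ ζ) / g (φ ζ)`, with `κ` chosen to cancel the nonconstant term of
`1 / (1 - |φ ζ|^2)` on the circle. -/
theorem eq_zero_of_apply_eq_zero {β : ℝ} (hβ : 0 < β) {σ g : ℂ → ℂ}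
    (hσ : AnalyticOnNhd ℂ σ (Metric.ball 0 1)) (hg : AnalyticOnNhd ℂ g (Metric.ball 0 1))
    (hmaps : MapsTo σ (Metric.ball 0 1) (Metric.ball 0 1))
    (heq : ∀ w ∈ Metric.ball (0 : ℂ) 1, discWeight β w * ‖g w‖ = discWeight β (σ w))
    {p : ℂ} (hp : p ∈ Metric.ball (0 : ℂ) 1) (hσp : σ p = 0) : p = 0 := by
  by_contra hp0
  have hp1 : ‖p‖ < 1 := mem_ball_zero_iff.1 hp
  set a := ‖p‖ ^ 2 with ha
  have ha0 : 0 < a := pow_pos (norm_pos_iff.2 hp0) 2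
  have ha1 : a < 1 := by nlinarith [norm_nonneg p]
  set l := 2 / β with hl
  have hl0 : 0 < l := by positivity
  -- any `ε < l * a` would do
  obtain ⟨C, hC⟩ := exists_abs_one_div_one_sub_rpow_le hβ (by positivity : 0 < l * a / 2)
  set ε := l * a / 2 with hε
  have hεl : ε < l := by nlinarith
  have hφm : MapsTo (discShift p) (Metric.ball 0 1) (Metric.ball 0 1) := fun ζ hζ =>
    mem_ball_zero_iff.2 (norm_discShift_lt_one hp1 (mem_ball_zero_iff.1 hζ))
  have hφd := differentiableOn_discShift hp1
  have hschwarz : ∀ ζ : ℂ, ‖ζ‖ < 1 → ‖σ (discShift p ζ)‖ ≤ ‖ζ‖ := fun ζ hζ =>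
    Complex.norm_le_norm_of_mapsTo_ball (f := σ ∘ discShift p)
      (hσ.differentiableOn.comp hφd hφm)
      (fun z hz => Metric.ball_subset_closedBall (hmaps (hφm hz)))
      (by simp [discShift_zero, hσp]) hζ
  have hlog : ∀ w ∈ Metric.ball (0 : ℂ) 1, g w ≠ 0 ∧ Real.log ‖g w‖ =
      1 / (1 - ‖w‖ ^ β) - 1 / (1 - ‖σ w‖ ^ β) := fun w hw => log_norm_eq_of_weight_eq (heq w hw)
  have key : ∀ r : ℝ, 0 < r → r < 1 →
      (l - ε) * (1 + a * r ^ 2) / (1 - a) - (l + ε) ≤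
        (2 * C + Real.log ‖g p‖) * (1 - r ^ 2) := by
    intro r hr0 hr1
    have hr2 : 0 < 1 - r ^ 2 := by nlinarith
    have ha1' : 0 < 1 - a := by linarith
    set κ : ℝ := 2 * (l - ε) / ((1 - a) * (1 - r ^ 2)) with hκ
    set M : ℝ := 2 * C - ((l - ε) * (1 + a * r ^ 2) / (1 - a) - (l + ε)) / (1 - r ^ 2) with hM
    let H : ℂ → ℂ := fun ζ => Complex.exp (κ * (conj p * ζ)) / g (discShift p ζ)
    have hcl : closure (Metric.ball (0 : ℂ) r) ⊆ Metric.ball 0 1 := by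
      rw [closure_ball _ hr0.ne']
      exact Metric.closedBall_subset_ball hr1
    have hH : DifferentiableOn ℂ H (Metric.ball 0 1) := by
      refine DifferentiableOn.div (by fun_prop) (hg.differentiableOn.comp hφd hφm) ?_
      exact fun ζ hζ => (hlog _ (hφm hζ)).1
    have hbd : ∀ ζ ∈ frontier (Metric.ball (0 : ℂ) r), ‖H ζ‖ ≤ Real.exp M := by
      intro ζ hζ
      rw [frontier_ball _ hr0.ne', mem_sphere_zero_iff_norm] at hζ
      have hζ1 : ‖ζ‖ < 1 := by rw [hζ]; exact hr1
      have hφ1 := norm_discShift_lt_one hp1 hζ1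
      obtain ⟨hg0, hgl⟩ := hlog _ (mem_ball_zero_iff.2 hφ1)
      have h1 := (abs_le.1 (hC _ (norm_nonneg _) hφ1)).1
      have h2 := (abs_le.1 (hC _ hr0.le hr1)).2
      have h3 := one_div_one_sub_rpow_le hβ (norm_nonneg _) (hschwarz ζ hζ1) hζ1
      rw [hζ] at h3
      have h4 : 1 / (1 - ‖discShift p ζ‖ ^ 2) =
          (1 + 2 * (conj p * ζ).re + a * r ^ 2) / ((1 - a) * (1 - r ^ 2)) := by
        rw [one_sub_norm_sq_discShift hp1 hζ1, norm_sq_one_add_conj_mul, one_div_div, hζ]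
      have h5 : (l - ε) / (1 - ‖discShift p ζ‖ ^ 2) =
          κ * (conj p * ζ).re + (l - ε) * (1 + a * r ^ 2) / (1 - a) / (1 - r ^ 2) := by
        rw [div_eq_mul_one_div, h4, hκ]
        field_simp
        ring
      have h6 : ‖H ζ‖ = Real.exp (κ * (conj p * ζ).re - Real.log ‖g (discShift p ζ)‖) := by
        rw [Real.exp_sub, Real.exp_log (norm_pos_iff.2 hg0), norm_div, Complex.norm_exp,
          Complex.re_ofReal_mul]
      rw [h6, Real.exp_le_exp, hgl, hM, sub_div]
      rw [sub_div] at h5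
      rw [add_div]
      linarith
    have h0 := Complex.norm_le_of_forall_mem_frontier_norm_le Metric.isBounded_ball
      ⟨hH.mono (subset_closure.trans hcl), hH.continuousOn.mono hcl⟩ hbd
      (subset_closure (Metric.mem_ball_self hr0))
    have h00 : ‖H 0‖ = Real.exp (- Real.log ‖g p‖) := by
      rw [Real.exp_neg, Real.exp_log (norm_pos_iff.2 (hlog p hp).1)]
      simp [H, discShift_zero]
    rw [h00, Real.exp_le_exp, hM] at h0
    rw [← div_le_iff₀ hr2]
    linarith
  have hlim1 : Tendsto (fun r : ℝ => (l - ε) * (1 + a * r ^ 2) / (1 - a) - (l + ε)) (𝓝[<] 1)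
      (𝓝 ((l - ε) * (1 + a * 1 ^ 2) / (1 - a) - (l + ε))) :=
    (Continuous.tendsto (by fun_prop) 1).mono_left nhdsWithin_le_nhds
  have hlim2 : Tendsto (fun r : ℝ => (2 * C + Real.log ‖g p‖) * (1 - r ^ 2)) (𝓝[<] 1)
      (𝓝 ((2 * C + Real.log ‖g p‖) * (1 - 1 ^ 2))) :=
    (Continuous.tendsto (by fun_prop) 1).mono_left nhdsWithin_le_nhds
  have hfin := le_of_tendsto_of_tendsto hlim1 hlim2 (by
    filter_upwards [Ioo_mem_nhdsLT (zero_lt_one (α := ℝ))] with r hr using key r hr.1 hr.2)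
  have : (l - ε) * (1 + a * 1 ^ 2) / (1 - a) ≤ l + ε := by linarith
  rw [div_le_iff₀ (by linarith)] at this
  nlinarith

/-- With `σ 0 = 0`, the Schwarz lemma gives `1 ≤ |g|` with equality at the origin, and the maximum
principle for `1 / g` makes `g` constant. -/
theorem exists_eq_rotation_of_weight_eq {β : ℝ} (hβ : 0 < β) {σ g : ℂ → ℂ}
    (hσ : AnalyticOnNhd ℂ σ (Metric.ball 0 1)) (hg : AnalyticOnNhd ℂ g (Metric.ball 0 1))
    (hmaps : MapsTo σ (Metric.ball 0 1) (Metric.ball 0 1))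
    (heq : ∀ w ∈ Metric.ball (0 : ℂ) 1, discWeight β w * ‖g w‖ = discWeight β (σ w))
    (hσ0 : σ 0 = 0) :
    ∃ α c : ℂ, ‖α‖ = 1 ∧ ‖c‖ = 1 ∧ ∀ w ∈ Metric.ball (0 : ℂ) 1, g w = α ∧ σ w = c * w := by
  have hUo : IsOpen (Metric.ball (0 : ℂ) 1) := Metric.isOpen_ball
  have hUc : IsPreconnected (Metric.ball (0 : ℂ) 1) := (convex_ball _ _).isPreconnected
  have h0 : (0 : ℂ) ∈ Metric.ball (0 : ℂ) 1 := Metric.mem_ball_self one_pos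
  have hlog : ∀ w ∈ Metric.ball (0 : ℂ) 1, g w ≠ 0 ∧ Real.log ‖g w‖ =
      1 / (1 - ‖w‖ ^ β) - 1 / (1 - ‖σ w‖ ^ β) := fun w hw => log_norm_eq_of_weight_eq (heq w hw)
  have hschwarz : ∀ w : ℂ, ‖w‖ < 1 → ‖σ w‖ ≤ ‖w‖ := fun w hw =>
    Complex.norm_le_norm_of_mapsTo_ball hσ.differentiableOn
      (fun z hz => Metric.ball_subset_closedBall (hmaps hz)) hσ0 hw
  have hg0 : ‖g 0‖ = 1 := by
    have h := hlog 0 h0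
    rw [hσ0, sub_self] at h
    exact Real.eq_one_of_pos_of_log_eq_zero (norm_pos_iff.2 h.1) h.2
  have hge : ∀ w ∈ Metric.ball (0 : ℂ) 1, 1 ≤ ‖g w‖ := by
    intro w hw
    obtain ⟨hne, hl⟩ := hlog w hw
    have hw1 := mem_ball_zero_iff.1 hw
    have := one_div_one_sub_rpow_le hβ (norm_nonneg _) (hschwarz w hw1) hw1
    rw [← Real.log_nonneg_iff (norm_pos_iff.2 hne), hl]
    linarith
  have hmax := Complex.eqOn_of_isPreconnected_of_isMaxOn_norm (f := fun w => (g w)⁻¹) hUc hUo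
    (hg.differentiableOn.inv fun w hw => (hlog w hw).1) h0 (by
      intro w hw
      simp only [mem_ofPred_eq, Function.comp, norm_inv, hg0, inv_one]
      exact inv_le_one_of_one_le₀ (hge w hw))
  have hconst : ∀ w ∈ Metric.ball (0 : ℂ) 1, g w = g 0 := fun w hw => inv_injective (hmax hw)
  have hnorm : ∀ w ∈ Metric.ball (0 : ℂ) 1, ‖σ w‖ = ‖w‖ := by
    intro w hw
    have h1 := heq w hw
    rw [hconst w hw, hg0, mul_one, discWeight, discWeight, Real.exp_eq_exp, neg_div, neg_div,
      neg_inj, one_div, one_div, inv_inj, sub_right_inj] at h1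
    exact ((Real.rpow_left_inj (norm_nonneg _) (norm_nonneg _) hβ.ne').1 h1).symm
  have hd : DifferentiableOn ℂ (dslope σ 0) (Metric.ball 0 1) :=
    (Complex.differentiableOn_dslope (hUo.mem_nhds h0)).2 hσ.differentiableOn
  have hdn : ∀ w ∈ Metric.ball (0 : ℂ) 1, w ≠ 0 → ‖dslope σ 0 w‖ = 1 := by
    intro w hw hw0
    rw [dslope_of_ne _ hw0, slope_def_field, hσ0, sub_zero, sub_zero, norm_div, hnorm w hw,
      div_self (norm_ne_zero_iff.2 hw0)]
  have hhalf : (1 / 2 : ℂ) ∈ Metric.ball (0 : ℂ) 1 := by simp; norm_num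
  have hc1 := hdn _ hhalf (by norm_num)
  have hle : ∀ w ∈ Metric.ball (0 : ℂ) 1, ‖dslope σ 0 w‖ ≤ 1 := fun w hw => by
    simpa using Complex.norm_dslope_le_div_of_mapsTo_ball (R₂ := 1) hσ.differentiableOn
      (by rw [hσ0]; exact fun z hz => Metric.ball_subset_closedBall (hmaps hz)) hw
  have hmax2 := Complex.eqOn_of_isPreconnected_of_isMaxOn_norm hUc hUo hd hhalf (fun w hw => by
    simp only [mem_ofPred_eq, Function.comp, hc1]
    exact hle w hw)
  refine ⟨g 0, dslope σ 0 (1 / 2), hg0, hc1, fun w hw => ⟨hconst w hw, ?_⟩⟩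
  have h1 : dslope σ 0 w = dslope σ 0 (1 / 2) := hmax2 hw
  rcases eq_or_ne w 0 with rfl | hw0
  · simp [hσ0]
  · rw [← h1, dslope_of_ne _ hw0, slope_def_field, hσ0, sub_zero, sub_zero,
      div_mul_cancel₀ _ hw0]

/-! ### Peak functions of the weighted spaces -/

/-- A rotation of `b` aligns it with `a`, making the triangle inequality an equality. -/
theorem exists_norm_add_smul_eq (a b : ℂ) :
    ∃ c : ℂ, ‖c‖ = 1 ∧ ∀ t : ℝ, 0 ≤ t → ‖a + t * (c * b)‖ = ‖a‖ + t * ‖b‖ := by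
  have key : ∀ a : ℂ, ∃ u : ℂ, ‖u‖ = 1 ∧ a = ‖a‖ * u := fun a =>
    ⟨Complex.exp (a.arg * Complex.I), Complex.norm_exp_ofReal_mul_I _,
      (Complex.norm_mul_exp_arg_mul_I a).symm⟩
  obtain ⟨u, hu, hau⟩ := key a
  obtain ⟨w, hw, hbw⟩ := key b
  have hw0 : w ≠ 0 := by
    rintro rfl
    simp at hw
  refine ⟨u / w, by rw [norm_div, hu, hw, div_one], fun t ht => ?_⟩
  have h1 : a + t * (u / w * b) = ((‖a‖ + t * ‖b‖ : ℝ) : ℂ) * u := by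
    have : u / w * b = ‖b‖ * u := by
      conv_lhs => rw [hbw]
      field_simp
    rw [this]
    conv_lhs => rw [hau]
    push_cast
    ring
  rw [h1, norm_mul, hu, mul_one, Complex.norm_real, Real.norm_of_nonneg (by positivity)]

namespace Hv

variable {U : Opens ℂ} {v : HolWeight U}

/-- The extension by zero of `f : Hv v` to the plane. -/
noncomputable def extend (f : Hv v) : ℂ → ℂ := Function.extend (Subtype.val : U → ℂ) f 0

theorem extend_coe (f : Hv v) (z : U) : f.extend z = f z := extend_val_apply _ z.2

theorem analyticOnNhd_extend (f : Hv v) : AnalyticOnNhd ℂ f.extend U :=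
  DifferentiableOn.analyticOnNhd f.2.1 U.isOpen

theorem continuous_coe (f : Hv v) : Continuous f := by
  have h := f.analyticOnNhd_extend.continuousOn.domRestrict
  exact h.congr fun z => f.extend_coe z

theorem continuous_weight_mul_norm (f : Hv v) : Continuous fun z => v z * ‖f z‖ :=
  v.continuous_toFun.mul f.continuous_coe.norm

theorem norm_le_of_forall_le {f : Hv v} {M : ℝ} (hM : 0 ≤ M) (h : ∀ z, v z * ‖f z‖ ≤ M) :
    ‖f‖ ≤ M := Real.iSup_le h hM

end Hv

namespace Hvo

variable {U : Opens ℂ} {v : HolWeight U}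

theorem norm_coe (f : Hvo v) : ‖(f : Hv v)‖ = ‖f‖ := rfl

/-- Boundedness of `v |F|` follows from its decay at the boundary. -/
theorem exists_of_isHolomorphicFun (F : U → ℂ) (hF : IsHolomorphicFun F)
    (h0 : ∀ ε : ℝ, 0 < ε → ∃ K : Set U, IsCompact K ∧ ∀ z ∉ K, v z * ‖F z‖ < ε) :
    ∃ f : Hvo v, ∀ z, (f : Hv v) z = F z := by
  have hc : Continuous F :=
    (ContinuousOn.domRestrict (DifferentiableOn.continuousOn hF)).congr
      fun z => extend_val_apply F z.2
  have hb : BddAbove (range fun z => v z * ‖F z‖) := by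
    obtain ⟨K, hK, h⟩ := h0 1 one_pos
    obtain ⟨B, hB⟩ := hK.bddAbove_image (v.continuous_toFun.mul hc.norm).continuousOn
    refine ⟨max B 1, ?_⟩
    rintro _ ⟨z, rfl⟩
    by_cases hz : z ∈ K
    · exact le_max_of_le_left (hB ⟨z, hz, rfl⟩)
    · exact le_max_of_le_right (h z hz).le
  exact ⟨⟨(⟨F, hF, hb⟩ : weightedHolSubmodule v), h0⟩, fun _ => rfl⟩

/-- The norm of a function in `Hvo v` is attained. -/
theorem exists_weight_mul_norm_eq_norm {f : Hvo v} (hf : f ≠ 0) :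
    ∃ w : U, v w * ‖(f : Hv v) w‖ = ‖f‖ := by
  obtain ⟨z, hz⟩ : ∃ z, (f : Hv v) z ≠ 0 := by
    by_contra! h
    exact hf (Subtype.ext (DFunLike.ext _ _ h))
  have hpos : 0 < v z * ‖(f : Hv v) z‖ := mul_pos (v.pos z) (norm_pos_iff.2 hz)
  obtain ⟨K, hK, hKz⟩ := f.2 _ hpos
  have hzK : z ∈ K := by
    by_contra h
    exact lt_irrefl _ (hKz z h)
  obtain ⟨w, hw, hmax⟩ :=
    hK.exists_isMaxOn ⟨z, hzK⟩ (Hv.continuous_weight_mul_norm (f : Hv v)).continuousOn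
  refine ⟨w, le_antisymm (Hv.le_norm _ w) (Hv.norm_le_of_forall_le
    (mul_nonneg (v.pos w).le (norm_nonneg _)) fun ζ => ?_)⟩
  by_cases h : ζ ∈ K
  · exact hmax h
  · exact (hKz ζ h).le.trans (hmax hzK)

/-- A functional that attains its norm at a function peaking only at `z` vanishes on all `f` with
`f z = 0`, because `‖p + t f‖ ≤ ‖p‖ + o(t)` as `t → 0`. -/
theorem apply_eq_zero_of_peak {p : Hvo v} {z : U} (hpz : (p : Hv v) z ≠ 0)
    (hp : ∀ ζ, ζ ≠ z → v ζ * ‖(p : Hv v) ζ‖ < v z * ‖(p : Hv v) z‖)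
    {L : Hvo v →ₗ[ℂ] ℂ} (hL : ∀ f, ‖L f‖ ≤ ‖f‖) (hLp : ‖p‖ ≤ ‖L p‖)
    {f : Hvo v} (hf : (f : Hv v) z = 0) : L f = 0 := by
  by_contra hLf
  set N := v z * ‖(p : Hv v) z‖
  have hN : 0 < N := mul_pos (v.pos z) (norm_pos_iff.2 hpz)
  set δ := ‖L f‖ / 2 with hδ
  have hLf' : 0 < ‖L f‖ := norm_pos_iff.2 hLf
  have hVopen : IsOpen {ζ | v ζ * ‖(f : Hv v) ζ‖ < δ} :=
    isOpen_lt (Hv.continuous_weight_mul_norm _) continuous_const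
  have hzV : z ∈ {ζ | v ζ * ‖(f : Hv v) ζ‖ < δ} := by
    show v z * ‖(f : Hv v) z‖ < δ
    rw [hf, norm_zero, mul_zero]
    positivity
  set V := {ζ | v ζ * ‖(f : Hv v) ζ‖ < δ}
  -- off the neighbourhood `V` of `z` the peak function stays away from its maximum
  obtain ⟨η, hη, hηV⟩ : ∃ η > 0, ∀ ζ ∉ V, v ζ * ‖(p : Hv v) ζ‖ ≤ N - η := by
    obtain ⟨K, hK, hKp⟩ := p.2 (N / 2) (half_pos hN)
    have hKV : IsCompact (K \ V) := hK.diff hVopen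
    rcases (K \ V).eq_empty_or_nonempty with he | hne
    · refine ⟨N / 2, half_pos hN, fun ζ hζ => ?_⟩
      have : ζ ∉ K := fun h => (he ▸ (⟨h, hζ⟩ : ζ ∈ K \ V) : ζ ∈ (∅ : Set U))
      linarith [hKp ζ this]
    · obtain ⟨m, hm, hmax⟩ :=
        hKV.exists_isMaxOn hne (Hv.continuous_weight_mul_norm (p : Hv v)).continuousOn
      have hmz : m ≠ z := fun h => hm.2 (h ▸ hzV)
      refine ⟨min (N / 2) (N - v m * ‖(p : Hv v) m‖),
        lt_min (half_pos hN) (sub_pos.2 (hp m hmz)), fun ζ hζ => ?_⟩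
      by_cases h : ζ ∈ K
      · have h1 : v ζ * ‖(p : Hv v) ζ‖ ≤ v m * ‖(p : Hv v) m‖ := hmax ⟨h, hζ⟩
        linarith [min_le_right (N / 2) (N - v m * ‖(p : Hv v) m‖)]
      · linarith [hKp ζ h, min_le_left (N / 2) (N - v m * ‖(p : Hv v) m‖)]
  set t := η / (‖f‖ + 1) with ht
  have hf1 : 0 < ‖f‖ + 1 := by positivity
  have ht0 : 0 < t := div_pos hη hf1
  have htf : t * ‖f‖ ≤ η := by
    rw [ht, div_mul_eq_mul_div, div_le_iff₀ hf1]
    nlinarith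
  obtain ⟨c, hc, hcL⟩ := exists_norm_add_smul_eq (L p) (L f)
  have h1 := hL (p + ((t : ℂ) * c) • f)
  rw [map_add, map_smul, smul_eq_mul, mul_assoc, hcL t ht0.le] at h1
  have h2 : ‖p + ((t : ℂ) * c) • f‖ ≤ N + t * δ := by
    refine Hv.norm_le_of_forall_le (by positivity) fun ζ => ?_
    have h3 : v ζ * ‖((p + ((t : ℂ) * c) • f : Hvo v) : Hv v) ζ‖ ≤
        v ζ * ‖(p : Hv v) ζ‖ + t * (v ζ * ‖(f : Hv v) ζ‖) := by
      have h4 : ((p + ((t : ℂ) * c) • f : Hvo v) : Hv v) ζ =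
        (p : Hv v) ζ + t * c * (f : Hv v) ζ := rfl
      have h5 := norm_add_le ((p : Hv v) ζ) (t * c * (f : Hv v) ζ)
      rw [norm_mul, norm_mul, hc, mul_one, Complex.norm_real, Real.norm_of_nonneg ht0.le] at h5
      rw [h4]
      nlinarith [v.pos ζ]
    refine h3.trans ?_
    by_cases hζ : ζ ∈ V
    · have h6 : v ζ * ‖(p : Hv v) ζ‖ ≤ N := by
        rcases eq_or_ne ζ z with rfl | h
        · exact le_rfl
        · exact (hp ζ h).le
      have h7 : v ζ * ‖(f : Hv v) ζ‖ < δ := hζ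
      nlinarith
    · have h8 : t * (v ζ * ‖(f : Hv v) ζ‖) ≤ t * ‖f‖ :=
        mul_le_mul_of_nonneg_left (Hv.le_norm _ ζ) ht0.le
      nlinarith [hηV ζ hζ]
  have h9 : N ≤ ‖p‖ := Hv.le_norm (p : Hv v) z
  nlinarith

end Hvo

theorem isCompact_norm_le {r : ℝ} (hr : r < 1) : IsCompact {z : openDisc | ‖(z : ℂ)‖ ≤ r} := by
  rw [Subtype.isCompact_iff]
  convert isCompact_closedBall (0 : ℂ) r using 1
  ext z
  rw [mem_closedBall_zero_iff]
  constructor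
  · rintro ⟨w, hw, rfl⟩
    exact hw
  · intro hz
    exact ⟨⟨z, mem_openDisc.2 (hz.trans_lt hr)⟩, hz, rfl⟩

theorem discWeight_le_one {β : ℝ} (hβ : 0 < β) {z : ℂ} (hz : ‖z‖ < 1) : discWeight β z ≤ 1 :=
  Real.exp_le_one_iff.2 (div_nonpos_of_nonpos_of_nonneg (by norm_num)
    (one_sub_norm_rpow_pos hβ hz).le)

theorem discWeight_le {β : ℝ} (hβ : 1 ≤ β) {z : ℂ} (hz : ‖z‖ < 1) :
    discWeight β z ≤ β * (1 - ‖z‖) := by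
  have hx := one_sub_norm_rpow_pos (by linarith : 0 < β) hz
  have h1 : discWeight β z ≤ 1 - ‖z‖ ^ β := by
    rw [discWeight, neg_div, Real.exp_neg]
    refine inv_le_of_inv_le₀ hx ?_
    have := Real.add_one_le_exp (1 / (1 - ‖z‖ ^ β))
    rw [one_div] at *
    linarith
  have h2 := one_add_mul_self_le_rpow_one_add (s := ‖z‖ - 1) (by linarith [norm_nonneg z]) hβ
  rw [add_sub_cancel] at h2
  linarith

/-- Strict convexity of `x ↦ 1 / (1 - x ^ β)` on `[0, 1)`: it lies strictly above its tangent at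
`s`, except at `s`. This is where `1 ≤ β` is needed. -/
theorem tangent_le_one_div_one_sub_rpow {s r : ℝ} (hβ : 1 ≤ β) (hs0 : 0 < s) (hs1 : s < 1)
    (hr0 : 0 ≤ r) (hr1 : r < 1) (hrs : r ≠ s) :
    1 / (1 - s ^ β) + β * s ^ (β - 1) / (1 - s ^ β) ^ 2 * (r - s) < 1 / (1 - r ^ β) := by
  have hβ0 : 0 < β := by linarith
  have hx0 : 0 < 1 - s ^ β := sub_pos.2 (Real.rpow_lt_one hs0.le hs1 hβ0)
  have hx : 0 < 1 - r ^ β := sub_pos.2 (Real.rpow_lt_one hr0 hr1 hβ0)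
  have hne : r ^ β ≠ s ^ β := fun h => hrs ((Real.rpow_left_inj hr0 hs0.le hβ0.ne').1 h)
  have hbern : s ^ β + β * s ^ (β - 1) * (r - s) ≤ r ^ β := by
    have h := one_add_mul_self_le_rpow_one_add (s := r / s - 1)
      (by linarith [div_nonneg hr0 hs0.le]) hβ
    rw [add_sub_cancel, Real.div_rpow hr0 hs0.le, le_div_iff₀ (by positivity)] at h
    rw [Real.rpow_sub_one hs0.ne']
    calc _ = (1 + β * (r / s - 1)) * s ^ β := by field_simp
      _ ≤ _ := h
  set x := r ^ β
  set y := s ^ β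
  have h1 : β * s ^ (β - 1) / (1 - y) ^ 2 * (r - s) ≤ (x - y) / (1 - y) ^ 2 := by
    rw [div_mul_eq_mul_div]
    gcongr
    linarith
  have h2 : 1 / (1 - x) - 1 / (1 - y) - (x - y) / (1 - y) ^ 2 =
      (x - y) ^ 2 / ((1 - x) * (1 - y) ^ 2) := by
    field_simp
    ring
  have h3 : 0 < (x - y) ^ 2 / ((1 - x) * (1 - y) ^ 2) := by
    have := sub_ne_zero.2 hne
    positivity
  linarith

namespace Hvo

variable {β : ℝ}

/-- The restriction of an entire function to the disc belongs to the space. -/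
theorem exists_of_differentiable (hβ : 1 ≤ β) {F : ℂ → ℂ} (hF : Differentiable ℂ F) :
    ∃ f : Hvo (expWeight β hβ), ∀ z, (f : Hv (expWeight β hβ)) z = F z := by
  refine exists_of_isHolomorphicFun (fun z => F z)
    (hF.differentiableOn.congr fun z hz => extend_val_apply _ hz) fun ε hε => ?_
  obtain ⟨B, hB⟩ := (isCompact_closedBall (0 : ℂ) 1).bddAbove_image hF.continuous.norm.continuousOn
  have hB' : ∀ z : openDisc, ‖F z‖ ≤ B := fun z =>
    hB ⟨z, mem_closedBall_zero_iff.2 (mem_openDisc.1 z.2).le, rfl⟩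
  have hB0 : 0 ≤ B := (norm_nonneg _).trans (hB' ⟨0, by simp [mem_openDisc]⟩)
  have hc : 0 < β * (B + 1) := by positivity
  refine ⟨_, isCompact_norm_le (r := 1 - ε / (β * (B + 1))) (by linarith [div_pos hε hc]),
    fun z hz => ?_⟩
  have hz1 : 1 - ε / (β * (B + 1)) < ‖(z : ℂ)‖ := not_le.1 hz
  have h1 := discWeight_le hβ (mem_openDisc.1 z.2)
  have h2 : (1 - ‖(z : ℂ)‖) * (β * (B + 1)) < ε := by
    rw [← lt_div_iff₀ hc]
    linarith
  rw [expWeight_apply]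
  have h3 := mul_le_mul h1 ((hB' z).trans (by linarith : B ≤ B + 1)) (norm_nonneg _)
    (by have := mem_openDisc.1 z.2; nlinarith)
  linarith

open ComplexConjugate in
/-- Every point of the disc is the only maximum point of `v |p|` for some `p`, namely
`p(ζ) = exp (u'(|z|) ē ζ)` with `z = |z| e`, and `p = 1` for `z = 0`. -/
theorem exists_peak (hβ : 1 ≤ β) (z : openDisc) : ∃ p : Hvo (expWeight β hβ),
    (p : Hv (expWeight β hβ)) z ≠ 0 ∧ ∀ ζ, ζ ≠ z →
      expWeight β hβ ζ * ‖(p : Hv (expWeight β hβ)) ζ‖ <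
        expWeight β hβ z * ‖(p : Hv (expWeight β hβ)) z‖ := by
  have hβ0 : 0 < β := by linarith
  have hz1 := mem_openDisc.1 z.2
  rcases eq_or_ne (z : ℂ) 0 with hz0 | hz0
  · obtain ⟨p, hp⟩ := exists_of_differentiable hβ (differentiable_const (1 : ℂ))
    refine ⟨p, by simp [hp], fun ζ hζ => ?_⟩
    have hζ0 : (ζ : ℂ) ≠ 0 := fun h => hζ (Subtype.ext (h.trans hz0.symm))
    have h1 := one_sub_norm_rpow_pos hβ0 (mem_openDisc.1 ζ.2)
    have h2 : 0 < ‖(ζ : ℂ)‖ ^ β := by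
      have := norm_pos_iff.2 hζ0
      positivity
    rw [hp, hp, expWeight_apply, expWeight_apply, norm_one, mul_one, mul_one, discWeight,
      discWeight, hz0, norm_zero, Real.zero_rpow hβ0.ne', Real.exp_lt_exp, neg_div, neg_div,
      neg_lt_neg_iff]
    exact one_div_lt_one_div_of_lt h1 (by linarith)
  · have hs : 0 < ‖(z : ℂ)‖ := norm_pos_iff.2 hz0
    set s := ‖(z : ℂ)‖ with hsdef
    set k := β * s ^ (β - 1) / (1 - s ^ β) ^ 2 with hk
    have hk0 : 0 < k := by
      have := one_sub_norm_rpow_pos hβ0 hz1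
      positivity
    obtain ⟨p, hp⟩ := exists_of_differentiable hβ (F := fun ζ => Complex.exp
      (((k / s : ℝ) : ℂ) * (conj (z : ℂ) * ζ))) (by fun_prop)
    have hnorm : ∀ ζ : openDisc, expWeight β hβ ζ * ‖(p : Hv (expWeight β hβ)) ζ‖ =
        Real.exp (k / s * (conj (z : ℂ) * ζ).re - 1 / (1 - ‖(ζ : ℂ)‖ ^ β)) := by
      intro ζ
      rw [hp, expWeight_apply, Complex.norm_exp, Complex.re_ofReal_mul, discWeight, ← Real.exp_add,
        neg_div]
      congr 1
      ring
    have hzz : (conj (z : ℂ) * z).re = s ^ 2 := by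
      rw [mul_comm, Complex.mul_conj, Complex.ofReal_re, Complex.normSq_eq_norm_sq]
    refine ⟨p, by simp [hp], fun ζ hζ => ?_⟩
    rw [hnorm, hnorm, Real.exp_lt_exp, hzz]
    have hre : (conj (z : ℂ) * ζ).re ≤ s * ‖(ζ : ℂ)‖ := by
      have := Complex.re_le_norm (conj (z : ℂ) * ζ)
      rwa [norm_mul, RCLike.norm_conj] at this
    have hks : k / s * s ^ 2 = k * s := by field_simp
    rw [hks]
    rcases eq_or_ne ‖(ζ : ℂ)‖ s with h | h
    · have hlt : (conj (z : ℂ) * ζ).re < s ^ 2 := by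
        refine lt_of_le_of_ne (by rw [h] at hre; linarith) fun heq => hζ (Subtype.ext ?_)
        have h0 : ‖(ζ : ℂ) - z‖ ^ 2 = 0 := by
          have e1 : ‖(ζ : ℂ) - z‖ ^ 2 = ‖(ζ : ℂ)‖ ^ 2 + s ^ 2 - 2 * (conj (z : ℂ) * ζ).re := by
            simp only [hsdef, ← Complex.normSq_eq_norm_sq, Complex.normSq_apply, Complex.sub_re,
              Complex.sub_im, Complex.mul_re, Complex.conj_re, Complex.conj_im]
            ring
          rw [e1, h, heq]
          ring
        exact sub_eq_zero.1 (norm_eq_zero.1 (pow_eq_zero_iff two_ne_zero |>.1 h0))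
      rw [h, sub_lt_sub_iff_right, ← hks]
      gcongr
    · have h1 := tangent_le_one_div_one_sub_rpow hβ hs hz1 (norm_nonneg _)
        (mem_openDisc.1 ζ.2) h
      have h2 : k / s * (conj (z : ℂ) * ζ).re ≤ k * ‖(ζ : ℂ)‖ := by
        calc _ ≤ k / s * (s * ‖(ζ : ℂ)‖) := by gcongr
          _ = _ := by field_simp
      rw [← hk] at h1
      linarith

end Hvo

/-! ### Isometries are weighted rotations -/

/-- Here `e` is the constant function `1`. The point `w` is one where `T p` attains its norm, for `p`
peaking at `z`. -/
theorem exists_apply_eq_mul_of_isometry {β : ℝ} {hβ : 1 ≤ β}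
    (T : Hvo (expWeight β hβ) →ₗᵢ[ℂ] Hvo (expWeight β hβ)) {e : Hvo (expWeight β hβ)}
    (he : ∀ z, (e : Hv (expWeight β hβ)) z = 1) (z : openDisc) :
    ∃ w : openDisc, (∀ f : Hvo (expWeight β hβ), (T f : Hv (expWeight β hβ)) w =
        (T e : Hv (expWeight β hβ)) w * (f : Hv (expWeight β hβ)) z) ∧
      expWeight β hβ w * ‖(T e : Hv (expWeight β hβ)) w‖ = expWeight β hβ z := by
  obtain ⟨p, hpz, hp⟩ := Hvo.exists_peak hβ z
  have hTp : T p ≠ 0 := by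
    rw [Ne, map_eq_zero_iff T T.injective]
    rintro rfl
    exact hpz rfl
  obtain ⟨w, hw⟩ := Hvo.exists_weight_mul_norm_eq_norm hTp
  rw [T.norm_map] at hw
  let L : Hvo (expWeight β hβ) →ₗ[ℂ] ℂ :=
    { toFun := fun f => (expWeight β hβ w : ℂ) * (T f : Hv (expWeight β hβ)) w
      map_add' := fun f g => by
        rw [map_add]
        exact mul_add _ _ _
      map_smul' := fun c f => by
        rw [map_smul]
        exact mul_left_comm _ _ _ }
  have hv := (expWeight β hβ).pos w
  have hLn : ∀ f, ‖L f‖ = expWeight β hβ w * ‖(T f : Hv (expWeight β hβ)) w‖ := fun f => by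
    change ‖(expWeight β hβ w : ℂ) * (T f : Hv (expWeight β hβ)) w‖ = _
    rw [norm_mul, Complex.norm_real, Real.norm_of_nonneg hv.le]
  have hL : ∀ f, ‖L f‖ ≤ ‖f‖ := fun f => by
    rw [hLn, ← T.norm_map]
    exact Hv.le_norm _ w
  have hzero : ∀ f : Hvo (expWeight β hβ), (f : Hv (expWeight β hβ)) z = 0 →
      (T f : Hv (expWeight β hβ)) w = 0 := fun f hf => by
    have h := Hvo.apply_eq_zero_of_peak hpz hp hL (by rw [hLn, hw]) hf
    exact (mul_eq_zero.1 h).resolve_left (by exact_mod_cast hv.ne')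
  have hmul : ∀ f : Hvo (expWeight β hβ), (T f : Hv (expWeight β hβ)) w =
      (T e : Hv (expWeight β hβ)) w * (f : Hv (expWeight β hβ)) z := fun f => by
    have h := hzero (f + (-(f : Hv (expWeight β hβ)) z) • e) (by
      change (f : Hv (expWeight β hβ)) z + -(f : Hv (expWeight β hβ)) z *
        (e : Hv (expWeight β hβ)) z = 0
      rw [he]
      ring)
    rw [map_add, map_smul] at h
    change (T f : Hv (expWeight β hβ)) w + -(f : Hv (expWeight β hβ)) z *
      (T e : Hv (expWeight β hβ)) w = 0 at h
    linear_combination h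
  refine ⟨w, hmul, ?_⟩
  have hp_norm : ‖p‖ = expWeight β hβ z * ‖(p : Hv (expWeight β hβ)) z‖ :=
    le_antisymm (Hv.norm_le_of_forall_le (mul_nonneg ((expWeight β hβ).pos z).le (norm_nonneg _))
      fun ζ => by
        rcases eq_or_ne ζ z with rfl | h
        · exact le_rfl
        · exact (hp ζ h).le) (Hv.le_norm (p : Hv (expWeight β hβ)) z)
  rw [hmul p, hp_norm, norm_mul, ← mul_assoc] at hw
  exact mul_right_cancel₀ (norm_ne_zero_iff.2 hpz) hw

/-- An isometry is a weighted composition operator `f ↦ g · (f ∘ σ)`. -/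
theorem exists_weighted_composition {β : ℝ} {hβ : 1 ≤ β}
    (T : Hvo (expWeight β hβ) →ₗᵢ[ℂ] Hvo (expWeight β hβ)) :
    ∃ g σ : ℂ → ℂ, AnalyticOnNhd ℂ g (Metric.ball 0 1) ∧ AnalyticOnNhd ℂ σ (Metric.ball 0 1) ∧
      MapsTo σ (Metric.ball 0 1) (Metric.ball 0 1) ∧
      (∀ z ∈ Metric.ball (0 : ℂ) 1, ∃ w ∈ Metric.ball (0 : ℂ) 1, σ w = z ∧
        discWeight β w * ‖g w‖ = discWeight β z) ∧
      ∀ (f : Hvo (expWeight β hβ)), ∀ w ∈ Metric.ball (0 : ℂ) 1,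
        (T f : Hv (expWeight β hβ)).extend w = g w * (f : Hv (expWeight β hβ)).extend (σ w) := by
  have hβ0 : 0 < β := by linarith
  have hUo : IsOpen (Metric.ball (0 : ℂ) 1) := Metric.isOpen_ball
  have hUc : IsPreconnected (Metric.ball (0 : ℂ) 1) := (convex_ball _ _).isPreconnected
  have hball : ∀ z : openDisc, (z : ℂ) ∈ Metric.ball (0 : ℂ) 1 := fun z => z.2
  have hpow : ∀ n : ℕ, ∃ f : Hvo (expWeight β hβ), ∀ z, (f : Hv (expWeight β hβ)) z = (z : ℂ) ^ n :=
    fun n => Hvo.exists_of_differentiable hβ (F := fun z => z ^ n) (by fun_prop)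
  choose m hm using hpow
  have hm_norm : ∀ n, ‖m n‖ ≤ 1 := fun n => by
    rw [← Hvo.norm_coe]
    refine Hv.norm_le_of_forall_le zero_le_one fun z => ?_
    rw [hm, norm_pow, expWeight_apply]
    exact mul_le_one₀ (discWeight_le_one hβ0 (mem_openDisc.1 z.2)) (by positivity)
      (pow_le_one₀ (norm_nonneg _) (mem_openDisc.1 z.2).le)
  choose W hWT hWv using exists_apply_eq_mul_of_isometry T (e := m 0) fun z => by simp [hm]
  set g := (T (m 0) : Hv (expWeight β hβ)).extend with hg
  set h := (T (m 1) : Hv (expWeight β hβ)).extend with hh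
  have hga : AnalyticOnNhd ℂ g (Metric.ball 0 1) := Hv.analyticOnNhd_extend _
  have hha : AnalyticOnNhd ℂ h (Metric.ball 0 1) := Hv.analyticOnNhd_extend _
  have hWg : ∀ (f : Hvo (expWeight β hβ)) (z : openDisc),
      (T f : Hv (expWeight β hβ)).extend (W z) = g (W z) * (f : Hv (expWeight β hβ)) z := by
    intro f z
    rw [hg, Hv.extend_coe, Hv.extend_coe, hWT z f]
  have hWh : ∀ z : openDisc, h (W z) = g (W z) * z := fun z => by
    rw [hh, hWg, hm, pow_one]
  have hWn : ∀ z : openDisc, discWeight β (W z) * ‖g (W z)‖ = discWeight β z := fun z => by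
    rw [hg, Hv.extend_coe]
    exact hWv z
  have hgW : ∀ z : openDisc, g (W z) ≠ 0 := fun z h0 => by
    have := hWn z
    rw [h0, norm_zero, mul_zero] at this
    exact (discWeight_pos β _).ne this
  have hWinj : Function.Injective W := fun a b hab => by
    have h1 := hWh a
    rw [hab, hWh b] at h1
    exact (Subtype.ext (mul_left_cancel₀ (hgW b) h1)).symm
  have hS : ¬ (range fun z => (W z : ℂ)).Countable := fun hc => by
    have h1 : (range (Subtype.val : openDisc → ℂ)).Countable := by
      have h2 := hc.preimage (f := fun z => (W z : ℂ)) (Subtype.val_injective.comp hWinj)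
      rw [preimage_range, countable_univ_iff] at h2
      exact countable_range _
    obtain ⟨z, hz, hz2⟩ := (h1.dense_compl ℝ).inter_open_nonempty _ hUo ⟨0, by simp⟩
    exact hz2 ⟨⟨z, hz⟩, rfl⟩
  have hSU : (range fun z => (W z : ℂ)) ⊆ Metric.ball 0 1 := range_subset_iff.2 fun z => (W z).2
  have hpoly : ∀ n : ℕ, EqOn
      (fun w => (T (m (n + 1)) : Hv (expWeight β hβ)).extend w * g w ^ n)
      (fun w => h w ^ (n + 1)) (Metric.ball 0 1) := fun n => by
    refine AnalyticOnNhd.eqOn_of_not_countable ((Hv.analyticOnNhd_extend _).mul (hga.pow n))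
      (hha.pow (n + 1)) hUc hSU hS ?_
    rintro _ ⟨z, rfl⟩
    simp only [hWg, hm, hWh]
    ring
  have hle : ∀ w ∈ Metric.ball (0 : ℂ) 1, g w ≠ 0 → ‖h w‖ ≤ ‖g w‖ := by
    intro w hw hgw
    have hgw' : 0 < ‖g w‖ := norm_pos_iff.2 hgw
    -- the powers of `h w / g w` are bounded
    by_contra! hlt
    have hq : 1 < ‖h w‖ / ‖g w‖ := (one_lt_div hgw').2 hlt
    have hb : ∀ n : ℕ, (‖h w‖ / ‖g w‖) ^ (n + 1) ≤ 1 / (discWeight β w * ‖g w‖) := by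
      intro n
      have h1 := congrArg norm (hpoly n hw)
      simp only [norm_mul, norm_pow] at h1
      have h2 : discWeight β w * ‖(T (m (n + 1)) : Hv (expWeight β hβ)).extend w‖ ≤ 1 := by
        have h3 := Hv.le_norm (T (m (n + 1)) : Hv (expWeight β hβ)) ⟨w, hw⟩
        rw [← Hv.extend_coe, Hvo.norm_coe, T.norm_map] at h3
        exact h3.trans (hm_norm _)
      have hv := discWeight_pos β w
      rw [div_pow, ← h1, div_le_div_iff₀ (by positivity) (by positivity)]
      calc _ = (discWeight β w * ‖(T (m (n + 1)) : Hv (expWeight β hβ)).extend w‖) *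
            ‖g w‖ ^ (n + 1) := by ring
        _ ≤ _ := by gcongr
    obtain ⟨n, hn⟩ := pow_unbounded_of_one_lt (1 / (discWeight β w * ‖g w‖)) hq
    have h4 : (‖h w‖ / ‖g w‖) ^ n ≤ (‖h w‖ / ‖g w‖) ^ (n + 1) :=
      pow_le_pow_right₀ hq.le n.le_succ
    linarith [hb n]
  have z0 : openDisc := ⟨0, by simp [mem_openDisc]⟩
  obtain ⟨σ, hσa, hσ⟩ := exists_analytic_quotient hUo hUc hga hha
    ⟨W z0, (W z0).2, hgW z0⟩ hle
  have hσW : ∀ z : openDisc, σ (W z) = z := fun z =>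
    mul_left_cancel₀ (hgW z) ((hσ (W z) (W z).2).1.symm.trans (hWh z))
  have hmaps : MapsTo σ (Metric.ball 0 1) (Metric.ball 0 1) := by
    intro w hw
    by_contra hcon
    have h1 : ‖σ w‖ = 1 := le_antisymm (hσ w hw).2 (by simpa using hcon)
    have hmax := Complex.norm_eqOn_of_isPreconnected_of_isMaxOn hUc hUo hσa.differentiableOn hw
      (fun x hx => by simpa [h1] using (hσ x hx).2)
    have h2 := hmax (W z0).2
    simp only [Function.comp, Function.const, hσW, h1] at h2
    exact (mem_openDisc.1 z0.2).ne h2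
  refine ⟨g, σ, hga, hσa, hmaps, fun z hz => ⟨W ⟨z, hz⟩, (W _).2, hσW ⟨z, hz⟩, hWn ⟨z, hz⟩⟩,
    fun f => ?_⟩
  refine AnalyticOnNhd.eqOn_of_not_countable (Hv.analyticOnNhd_extend _)
    (hga.mul ((Hv.analyticOnNhd_extend (f : Hv (expWeight β hβ))).comp hσa hmaps)) hUc hSU hS ?_
  rintro _ ⟨z, rfl⟩
  simp only [hWg, hσW, Hv.extend_coe]

theorem norm_discRotation (θ : ℝ) (z : openDisc) : ‖(discRotation θ z : ℂ)‖ = ‖(z : ℂ)‖ := by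
  simp only [discRotation, norm_mul, Complex.norm_exp_ofReal_mul_I, one_mul]

theorem discRotation_neg_discRotation (θ : ℝ) (z : openDisc) :
    discRotation (-θ) (discRotation θ z) = z := by
  refine Subtype.ext ?_
  simp only [discRotation, ← mul_assoc, ← Complex.exp_add]
  simp

theorem Hvo.exists_comp_discRotation {β : ℝ} {hβ : 1 ≤ β} (f : Hvo (expWeight β hβ)) (θ : ℝ) :
    ∃ k : Hvo (expWeight β hβ), ∀ z,
      (k : Hv (expWeight β hβ)) z = (f : Hv (expWeight β hβ)) (discRotation θ z) := by
  have hcont : Continuous (discRotation θ) :=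
    Continuous.subtype_mk (continuous_const.mul continuous_subtype_val) _
  refine Hvo.exists_of_isHolomorphicFun (fun z => (f : Hv (expWeight β hβ)) (discRotation θ z))
    ?_ fun ε hε => ?_
  · have h1 : DifferentiableOn ℂ (fun z : ℂ => Complex.exp (θ * Complex.I) * z)
        (openDisc : Set ℂ) := by fun_prop
    refine ((Hv.analyticOnNhd_extend (f : Hv (expWeight β hβ))).differentiableOn.comp h1
      fun z hz => (discRotation θ ⟨z, hz⟩).2).congr fun z hz => ?_
    rw [extend_val_apply _ hz, ← Hv.extend_coe]
    rfl
  · obtain ⟨K, hK, h⟩ := f.2 ε hε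
    refine ⟨discRotation (-θ) '' K, hK.image ?_, fun z hz => ?_⟩
    · exact Continuous.subtype_mk (continuous_const.mul continuous_subtype_val) _
    · have h1 : discRotation θ z ∉ K := fun hK' =>
        hz ⟨_, hK', discRotation_neg_discRotation θ z⟩
      have h2 := h _ h1
      rw [expWeight_apply, discWeight, norm_discRotation] at h2
      exact h2

theorem theorem5p3 (β : ℝ) (hβ : 1 ≤ β)
    (T : Hvo (expWeight β hβ) →ₗᵢ[ℂ] Hvo (expWeight β hβ)) :
    (∃ α : ℂ, ∃ θ : ℝ, ‖α‖ = 1 ∧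
      ∀ (f : Hvo (expWeight β hβ)) (z : openDisc),
        (T f : Hv (expWeight β hβ)) z =
          α * (f : Hv (expWeight β hβ)) (discRotation θ z)) ∧
    Function.Surjective T := by
  have hβ0 : 0 < β := by linarith
  obtain ⟨g, σ, hg, hσ, hmaps, hsurj, hT⟩ := exists_weighted_composition T
  have heq := weight_eq_on_ball hβ0 hσ hg hmaps hsurj
  obtain ⟨p, hp, hσp, -⟩ := hsurj 0 (Metric.mem_ball_self one_pos)
  have hp0 := eq_zero_of_apply_eq_zero hβ0 hσ hg hmaps heq hp hσp
  rw [hp0] at hσp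
  obtain ⟨α, c, hα, hc, hαc⟩ := exists_eq_rotation_of_weight_eq hβ0 hσ hg hmaps heq hσp
  have hcθ : c = Complex.exp (c.arg * Complex.I) := by
    have := Complex.norm_mul_exp_arg_mul_I c
    rw [hc, Complex.ofReal_one, one_mul] at this
    exact this.symm
  have hmain : ∀ (f : Hvo (expWeight β hβ)) (z : openDisc), (T f : Hv (expWeight β hβ)) z =
      α * (f : Hv (expWeight β hβ)) (discRotation c.arg z) := by
    intro f z
    rw [← Hv.extend_coe, ← Hv.extend_coe, hT f z z.2, (hαc z z.2).1, (hαc z z.2).2]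
    simp only [discRotation, ← hcθ]
  refine ⟨⟨α, c.arg, hα, hmain⟩, fun k => ?_⟩
  obtain ⟨f, hf⟩ := Hvo.exists_comp_discRotation k (-c.arg)
  have hα0 : α ≠ 0 := by
    rintro rfl
    simp at hα
  refine ⟨α⁻¹ • f, Subtype.ext (DFunLike.ext _ _ fun z => ?_)⟩
  rw [map_smul]
  change α⁻¹ * (T f : Hv (expWeight β hβ)) z = _
  rw [hmain, hf, discRotation_neg_discRotation, inv_mul_cancel_left₀ hα0]
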